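/- **Definitions.** Let $f:\mathbb{F}_2^n\to\mathbb{F}_2$. * For $x\in\mathbb F_2^n$ and $S\subseteq[n]$ let $x^{(S)}$ be $x$ with the bits in $S$ flipped. $f$ is *$k$-th order sensitive* if there is an $x$ with $f(x)\ne f(x^{(S)})$ for all $S\subseteq[n]$ with $1\le |S|\le k$. * The *real polynomial degree* $\mathsf{pdeg}(f)$ is the largest Hamming weight $wt(w)$ of a $w\in\mathbb{F}_2^n$ with $W_f(w)=\sum_{x}(-1)^{f(x)+w\cdot x}\neq 0$ (equivalently, the degree of the multilinear real polynomial that represents $f$). * $\mathrm{sym}^k_m:\mathbb F_2^m\to\mathbb F_2$ is the sum over $\mathbb F_2$ of all monomials $\prod_{i\in S}y_i$ with $1\le|S|\le k$. * $\mathbb{MM}_n^k$ is the class of Maiorana–McFarland type functions $f(x,y)=\bigoplus_{a\in\mathbb F_2^{n_1}} ac_a(x)\,g_a(y)$, where $n=n_1+n_2$, $x\in\mathbb F_2^{n_1}$ is formed by the first $n_1$ variables, $y\in\mathbb F_2^{n_2}$ by the last $n_2$, $k\le n_2$, $ac_a(x)=1$ if $x=a$ and $0$ otherwise, and the functions $g_a:\mathbb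 F_2^{n_2}\to\mathbb F_2$ satisfy $g_{(1,\dots,1)}=\mathrm{sym}^k_{n_2}$ and $g_a=1$ for all $a$ with $n_1-k\le wt(a)<n_1$; the other $g_a$ are arbitrary. Here the variables are split into halves: $n_1=\lceil n/2\rceil$, $n_2=\lfloor n/2\rfloor$. **Theorem.** 1. For all integers $k\ge1$ and $n\ge 4k$ there is a $k$-th order sensitive function $f\in\mathbb{MM}_n^k$ with $$\mathsf{pdeg}(f)=\left\lfloor n-\frac{\log_2\left(\frac n2-k\right)-\log_2 k}{k}\right\rfloor .$$ 2. Let $k:\mathbb N\to\mathbb N$ satisfy $k(n)\ge1$ for all large $n$ and $k(n)=o(\log n)$. Then there are functions $f_n:\mathbb F_2^n\to\mathbb F_2$ such that, for all large $n$, $f_n\in\mathbb{MM}_n^{k(n)}$ is $k(n)$-th order sensitive, and $n-\mathsf{pdeg}(f_n)\to\infty$. 3. In particular, there are a function $k:\mathbb N\to\mathbb N$ with $k(n)\to\infty$ and functions $f_n:\mathbb F_2^n\to\mathbb F_2$ such that, for all large $n$, $f_n\in\mathbb{MM}_n^{k(n)}$ is $k(n)$-th order sensitive, and $n-\mathsf{pdeg}(f_n)\to\infty$: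 sensitivity of order $\omega(1)$ together with real polynomial degree $n-\omega(1)$. -/

import Mathlib

open Filter Asymptotics

namespace MMSens

/-- The input `x^(S)`: the bits of `x` indexed by `S` are flipped. -/
def flipBits {n : ℕ} (x : Fin n → ZMod 2) (S : Finset (Fin n)) : Fin n → ZMod 2 :=
  fun i => if i ∈ S then x i + 1 else x i

/-- `f` is `k`-th order sensitive: at some input, flipping the bits in any set `S` with
`1 ≤ |S| ≤ k` changes the value of `f`. -/
def IsSensitiveOfOrder {n : ℕ} (k : ℕ) (f : (Fin n → ZMod 2) → ZMod 2) : Prop :=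
  ∃ x : Fin n → ZMod 2, ∀ S : Finset (Fin n), 1 ≤ S.card → S.card ≤ k →
    f x ≠ f (flipBits x S)

/-- The (unnormalised) Fourier spectrum of a Boolean function,
`W_f(w) = ∑_x (-1)^(f(x) + w · x)`. -/
def walsh {n : ℕ} (f : (Fin n → ZMod 2) → ZMod 2) (w : Fin n → ZMod 2) : ℤ :=
  ∑ x : Fin n → ZMod 2, (-1) ^ (f x + ∑ i, w i * x i).val

/-- The real polynomial degree of a Boolean function: the largest Hamming weight of a point at
which the Fourier spectrum does not vanish. -/
def pdeg {n : ℕ} (f : (Fin n → ZMod 2) → ZMod 2) : ℕ :=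
  (Finset.univ.filter fun w : Fin n → ZMod 2 => walsh f w ≠ 0).sup hammingNorm

/-- `sym^k_m`: the sum over `F_2` of all monomials of degree between `1` and `k` in `m`
variables. -/
def sym (k m : ℕ) (y : Fin m → ZMod 2) : ZMod 2 :=
  ∑ S : Finset (Fin m) with 1 ≤ S.card ∧ S.card ≤ k, ∏ i ∈ S, y i

/-- The polynomial over `F_2` that is `1` at `a` and `0` at every other point. -/
def ac {m : ℕ} (a x : Fin m → ZMod 2) : ZMod 2 :=
  ∏ i, (x i + a i + 1)

/-- The Maiorana--McFarland type functions
`f(x, y) = ⨁_a ac_a(x) g_a(y)`, with `x` the first `n₁` and `y` the last `n₂` of the `n`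
variables, such that `g_a = sym^k` for the all-one point `a`, and `g_a = 1` for all
`a` with `n₁ - k ≤ wt(a) < n₁`. -/
def MMSplit {n₁ n₂ n : ℕ} (h : n₁ + n₂ = n) (k : ℕ) : Set ((Fin n → ZMod 2) → ZMod 2) :=
  {f | k ≤ n₂ ∧ ∃ g : (Fin n₁ → ZMod 2) → (Fin n₂ → ZMod 2) → ZMod 2,
    g (fun _ => 1) = sym k n₂ ∧
    (∀ a, hammingNorm a < n₁ → n₁ ≤ hammingNorm a + k → g a = fun _ => 1) ∧
    ∀ (x : Fin n₁ → ZMod 2) (y : Fin n₂ → ZMod 2),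
      f (fun i => Fin.append x y (Fin.cast h.symm i)) = ∑ a, ac a x * g a y}

/-- The functions of the class above for which the `n` variables are split into two halves,
`n₁ = n₂` or, for odd `n`, `n₁ = n₂ + 1`. -/
def MM (n k : ℕ) : Set ((Fin n → ZMod 2) → ZMod 2) :=
  {f | ∃ (n₁ n₂ : ℕ) (h : n₁ + n₂ = n), (n₁ = n₂ ∨ n₁ = n₂ + 1) ∧ f ∈ MMSplit h k}

end MMSens

namespace MMSens

/-! Membership in the class already forces sensitivity at `(1, 0)`. There `f = sym^k(0) = 0`.
Flipping `1` to `k` bits leads to a piece `g_a = 1` if some bit of `x` changes, and otherwise to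
`sym^k` at weight between `1` and `k`, which is `1`. Only the degree needs a construction.

For `v ≠ 0` the constant pieces drop out of `W_f(u, v) = ∑_a (-1)^(u·a) W_{g_a}(v)`. The nonconstant
pieces live on a set `A` containing the all-one point (`blockConst`), where `g_a` is `sym^k` up to a
constant, and on an optional set `A'` (`headCube`), where it is the parity up to a constant. The
constants `u₀·(a+1)` shift the spectrum by `u₀` = `offHeads`, which has `d` zeros, one at the head
of each of `d` blocks of length `k+1`.

If `wt(u, v) > n - d`, then `u` is all-one on some block, and a translation of `A` and of `A'`
supported there flips every sign, so `W_f` vanishes. At `(u₀, 1)`, of weight `n - d`, both sums are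
cardinalities. `A'` is needed only if the spectrum of `sym^k` vanishes at the all-one point. Thus
`pdeg f = n - d` (`exists_mem_MMSplit_pdeg_eq`), and `d` is the ceiling of the logarithmic
expression. -/

/-! ### Signs and Walsh spectra. -/

/-- The sign `(-1)^z` of a bit `z`. -/
def sign (z : ZMod 2) : ℤ := (-1) ^ z.val

theorem sign_add (a b : ZMod 2) : sign (a + b) = sign a * sign b := by
  revert a b; decide

theorem sign_zero : sign 0 = 1 := rfl

theorem sign_mul_self (a : ZMod 2) : sign a * sign a = 1 := by
  revert a; decide

theorem sign_ne_zero (a : ZMod 2) : sign a ≠ 0 := by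
  revert a; decide

theorem walsh_eq {n : ℕ} (f : (Fin n → ZMod 2) → ZMod 2) (w : Fin n → ZMod 2) :
    walsh f w = ∑ x, sign (f x) * sign (w ⬝ᵥ x) :=
  Finset.sum_congr rfl fun _ _ => sign_add _ _

theorem eq_zero_or_one (z : ZMod 2) : z = 0 ∨ z = 1 := by
  revert z; decide

/-- The involution `a ↦ a + t` pairs terms of opposite sign. -/
theorem sum_sign_dotProduct_eq_zero {m : ℕ} {A : Finset (Fin m → ZMod 2)}
    {w t : Fin m → ZMod 2} (hA : ∀ a ∈ A, a + t ∈ A) (hw : w ⬝ᵥ t = 1) :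
    ∑ a ∈ A, sign (w ⬝ᵥ a) = 0 := by
  refine Finset.sum_involution (fun a _ => a + t) ?_ ?_ hA ?_
  · intro a _
    rw [dotProduct_add, hw, sign_add]
    simp [sign, ZMod.val_one]
  · intro a _ _ h
    have : t = 0 := by simpa using h
    simp [this] at hw
  · intro a _
    funext i
    have : ∀ x y : ZMod 2, x + y + y = x := by decide
    exact this _ _

theorem walsh_add_const {n : ℕ} (p : (Fin n → ZMod 2) → ZMod 2) (c : ZMod 2)
    (v : Fin n → ZMod 2) : walsh (fun y => p y + c) v = sign c * walsh p v := by
  simp only [walsh_eq, sign_add, Finset.mul_sum]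
  exact Finset.sum_congr rfl fun _ _ => by ring

theorem walsh_one {n : ℕ} {v : Fin n → ZMod 2} (hv : v ≠ 0) : walsh (fun _ => 1) v = 0 := by
  obtain ⟨i, hi⟩ := Function.ne_iff.mp hv
  rw [walsh_eq, ← Finset.mul_sum,
    sum_sign_dotProduct_eq_zero (t := Pi.single i 1) (by simp), mul_zero]
  simpa using (eq_zero_or_one (v i)).resolve_left hi

theorem walsh_sum_one (n : ℕ) : walsh (fun y : Fin n → ZMod 2 => ∑ i, y i) (fun _ => 1) ≠ 0 := by
  have h : ∀ y : Fin n → ZMod 2, (fun _ => 1) ⬝ᵥ y = ∑ i, y i := fun y => by simp [dotProduct]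
  simp [walsh_eq, h, sign_mul_self]

theorem walsh_append {n₁ n₂ : ℕ} {f : (Fin (n₁ + n₂) → ZMod 2) → ZMod 2}
    {g : (Fin n₁ → ZMod 2) → (Fin n₂ → ZMod 2) → ZMod 2}
    (hf : ∀ x y, f (Fin.append x y) = g x y) (u : Fin n₁ → ZMod 2) (v : Fin n₂ → ZMod 2) :
    walsh f (Fin.append u v) = ∑ a, sign (u ⬝ᵥ a) * walsh (g a) v := by
  rw [walsh_eq, ← (Fin.appendEquiv n₁ n₂).sum_comp, Fintype.sum_prod_type]
  refine Finset.sum_congr rfl fun a _ => ?_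
  rw [walsh_eq, Finset.mul_sum]
  refine Finset.sum_congr rfl fun y _ => ?_
  have h : Fin.append u v ⬝ᵥ Fin.append a y = u ⬝ᵥ a + v ⬝ᵥ y := by
    simp [dotProduct, Fin.sum_univ_add]
  change sign (f (Fin.append a y)) * sign (Fin.append u v ⬝ᵥ Fin.append a y) = _
  rw [hf, h, sign_add]
  ring

theorem hammingNorm_append {n₁ n₂ : ℕ} (u : Fin n₁ → ZMod 2) (v : Fin n₂ → ZMod 2) :
    hammingNorm (Fin.append u v) = hammingNorm u + hammingNorm v := by
  simp only [hammingNorm, Finset.card_filter, Fin.sum_univ_add, Fin.append_left, Fin.append_right]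

/-! ### The functions `ac` and `sym`, and sensitivity of the class. -/

theorem ac_eq {m : ℕ} (a x : Fin m → ZMod 2) : ac a x = if a = x then 1 else 0 := by
  split_ifs with h
  · subst h
    have : ∀ z : ZMod 2, z + z + 1 = 1 := by decide
    simp [ac, this]
  · obtain ⟨i, hi⟩ := Function.ne_iff.mp h
    refine Finset.prod_eq_zero (Finset.mem_univ i) ?_
    revert hi
    generalize a i = p; generalize x i = q
    revert p q; decide

theorem sum_ac_mul {m : ℕ} {Y : Type*} (g : (Fin m → ZMod 2) → Y → ZMod 2)
    (x : Fin m → ZMod 2) (y : Y) : ∑ a, ac a x * g a y = g x y := by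
  simp [ac_eq]

theorem sym_zero (k m : ℕ) : sym k m 0 = 0 := by
  refine Finset.sum_eq_zero fun S hS => ?_
  obtain ⟨i, hi⟩ := Finset.card_pos.mp (Finset.mem_filter.mp hS).2.1
  exact Finset.prod_eq_zero hi rfl

/-- On points of weight between `1` and `k` the function `sym^k` takes the value `1`. -/
theorem sym_indicator {k m : ℕ} (T : Finset (Fin m)) (h1 : 1 ≤ T.card) (hk : T.card ≤ k) :
    sym k m (fun i => if i ∈ T then 1 else 0) = 1 := by
  have key : ∀ S : Finset (Fin m), ∏ i ∈ S, (if i ∈ T then (1 : ZMod 2) else 0) =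
      if S ⊆ T then 1 else 0 := fun S => by
    rw [Finset.prod_ite_zero]; simp [Finset.subset_iff]
  simp only [sym, key]
  rw [← Finset.sum_filter, Finset.filter_filter]
  have hs : (Finset.univ.filter fun S : Finset (Fin m) => (1 ≤ S.card ∧ S.card ≤ k) ∧ S ⊆ T) =
      T.powerset.erase ∅ := by
    ext S
    simp only [Finset.mem_filter, Finset.mem_univ, true_and, Finset.mem_erase,
      Finset.mem_powerset, Nat.one_le_iff_ne_zero, Ne, Finset.card_eq_zero]
    exact ⟨fun h => ⟨h.1.1, h.2⟩, fun h => ⟨⟨h.1, (Finset.card_le_card h.2).trans hk⟩, h.2⟩⟩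
  -- The monomials equal to `1` are the nonempty subsets of `T`, and `2^|T| - 1` is odd.
  rw [hs, Finset.sum_const, nsmul_one, Finset.card_erase_of_mem (Finset.empty_mem_powerset T),
    Finset.card_powerset, Nat.cast_sub Nat.one_le_two_pow]
  have : (2 : ZMod 2) = 0 := rfl
  simp [this, Nat.one_le_iff_ne_zero.mp h1]

theorem sym_one (m : ℕ) : sym 1 m = fun y => ∑ i, y i := by
  funext y
  have hs : (Finset.univ.filter fun S : Finset (Fin m) => 1 ≤ S.card ∧ S.card ≤ 1) =
      Finset.univ.map ⟨fun i => {i}, Finset.singleton_injective⟩ := by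
    ext S
    simp only [Finset.mem_filter, Finset.mem_univ, true_and,
      ← le_antisymm_iff, Finset.card_eq_one, Finset.mem_map, Function.Embedding.coeFn_mk, eq_comm]
  rw [sym, hs, Finset.sum_map]
  simp

theorem isSensitiveOfOrder_of_mem_MMSplit {n₁ n₂ n k : ℕ} {h : n₁ + n₂ = n}
    {f : (Fin n → ZMod 2) → ZMod 2} (hf : f ∈ MMSplit h k) : IsSensitiveOfOrder k f := by
  subst h
  obtain ⟨-, g, hg1, hg, hfg⟩ := hf
  replace hfg : ∀ x y, f (Fin.append x y) = g x y := fun x y =>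
    (hfg x y).trans (sum_ac_mul g x y)
  refine ⟨Fin.append (fun _ => 1) 0, fun S hS hSk => ?_⟩
  set S₁ : Finset (Fin n₁) := Finset.univ.filter fun i => Fin.castAdd n₂ i ∈ S with hS₁
  set S₂ : Finset (Fin n₂) := Finset.univ.filter fun i => Fin.natAdd n₁ i ∈ S with hS₂
  have hcard : S₁.card + S₂.card = S.card := by
    have : S.card = ∑ i, if i ∈ S then 1 else 0 := by simp
    rw [this, hS₁, hS₂, Finset.card_filter, Finset.card_filter, Fin.sum_univ_add]
  have hflip : flipBits (Fin.append (fun _ => 1) 0) S =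
      Fin.append (fun i => if i ∈ S₁ then (0 : ZMod 2) else 1)
        (fun i => if i ∈ S₂ then (1 : ZMod 2) else 0) := by
    have h2 : (1 + 1 : ZMod 2) = 0 := rfl
    funext i
    refine Fin.addCases (fun i => ?_) (fun i => ?_) i <;> simp [flipBits, hS₁, hS₂, h2]
  have h0 : f (Fin.append (fun _ => 1) 0) = 0 := by
    rw [hfg, hg1]; exact sym_zero _ _
  rw [h0, hflip, hfg]
  suffices hs : g (fun i => if i ∈ S₁ then (0 : ZMod 2) else 1)
      (fun i => if i ∈ S₂ then (1 : ZMod 2) else 0) = 1 by rw [hs]; decide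
  rcases S₁.eq_empty_or_nonempty with he | he
  · simp only [he, Finset.notMem_empty, if_false, hg1]
    rw [he, Finset.card_empty, zero_add] at hcard
    exact sym_indicator _ (by omega) (by omega)
  · have hn : hammingNorm (fun i => if i ∈ S₁ then (0 : ZMod 2) else 1) = n₁ - S₁.card := by
      simp [hammingNorm, Finset.filter_not, Finset.card_univ_sdiff]
    have := he.card_pos
    have h3 : S₁.card ≤ n₁ := by simpa using S₁.card_le_univ
    rw [hg _ (by omega) (by omega)]

/-- The twist by `u₀` turns the characters `u` into `u + u₀`; the constant pieces contribute nothing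
because `v ≠ 0`. -/
theorem walsh_of_two_pieces {n₁ n₂ : ℕ} {f : (Fin (n₁ + n₂) → ZMod 2) → ZMod 2}
    {A A' : Finset (Fin n₁ → ZMod 2)} (hA : Disjoint A A') {u₀ : Fin n₁ → ZMod 2}
    {p q : (Fin n₂ → ZMod 2) → ZMod 2}
    (hf : ∀ x y, f (Fin.append x y) = if x ∈ A then p y + u₀ ⬝ᵥ (x + 1) else
      if x ∈ A' then q y + u₀ ⬝ᵥ (x + 1) else 1)
    (u : Fin n₁ → ZMod 2) {v : Fin n₂ → ZMod 2} (hv : v ≠ 0) :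
    walsh f (Fin.append u v) = sign (u₀ ⬝ᵥ 1) *
      ((∑ a ∈ A, sign ((u + u₀) ⬝ᵥ a)) * walsh p v +
        (∑ a ∈ A', sign ((u + u₀) ⬝ᵥ a)) * walsh q v) := by
  have h : ∀ a, sign (u ⬝ᵥ a) * walsh (fun y => if a ∈ A then p y + u₀ ⬝ᵥ (a + 1) else
      if a ∈ A' then q y + u₀ ⬝ᵥ (a + 1) else 1) v = sign (u₀ ⬝ᵥ 1) *
      ((if a ∈ A then sign ((u + u₀) ⬝ᵥ a) else 0) * walsh p v +
        (if a ∈ A' then sign ((u + u₀) ⬝ᵥ a) else 0) * walsh q v) := by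
    intro a
    by_cases h1 : a ∈ A
    · simp only [h1, Finset.disjoint_left.mp hA h1, if_true, if_false, walsh_add_const,
        dotProduct_add, add_dotProduct, sign_add]
      ring
    · by_cases h2 : a ∈ A'
      · simp only [h1, h2, if_true, if_false, walsh_add_const, dotProduct_add, add_dotProduct,
          sign_add]
        ring
      · simp [h1, h2, walsh_one hv]
  rw [walsh_append hf, Finset.sum_congr rfl fun a _ => h a, ← Finset.mul_sum,
    Finset.sum_add_distrib, ← Finset.sum_mul, ← Finset.sum_mul, Finset.sum_ite_mem,
    Finset.sum_ite_mem, Finset.univ_inter, Finset.univ_inter]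

/-! ### Blocks, their heads, and the supports `A` and `A'`. -/

theorem hammingNorm_add_card_zeros {m : ℕ} (a : Fin m → ZMod 2) :
    hammingNorm a + (Finset.univ.filter fun i => a i = 0).card = m := by
  have := Finset.card_filter_add_card_filter_not (s := Finset.univ) (fun i => a i ≠ 0)
  simpa [hammingNorm] using this

/-- The first elements of the first `d` blocks of `k + 1` consecutive indices. -/
def blockHeads (m k d : ℕ) : Finset (Fin m) :=
  Finset.univ.filter fun i => i.val < d * (k + 1) ∧ (k + 1) ∣ i.val

theorem card_blockHeads_le (m k d : ℕ) : (blockHeads m k d).card ≤ d := by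
  refine (Finset.card_le_card_of_injOn (t := Finset.range d) (fun i => i.val / (k + 1)) ?_ ?_).trans
    (Finset.card_range d).le
  · intro i hi
    exact Finset.mem_coe.mpr (Finset.mem_range.mpr (Nat.div_lt_of_lt_mul (by
      rw [mul_comm]; exact (Finset.mem_filter.mp hi).2.1)))
  · intro i hi j hj hij
    refine Fin.ext ?_
    rw [← Nat.div_mul_cancel (Finset.mem_filter.mp hi).2.2,
      ← Nat.div_mul_cancel (Finset.mem_filter.mp hj).2.2]
    exact congrArg (· * (k + 1)) hij

/-- The point that vanishes exactly at the heads of the first `d` blocks. -/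
def offHeads (m k d : ℕ) (i : Fin m) : ZMod 2 := if i ∈ blockHeads m k d then 0 else 1

theorem le_hammingNorm_offHeads_add (m k d : ℕ) : m ≤ hammingNorm (offHeads m k d) + d := by
  have h := hammingNorm_add_card_zeros (offHeads m k d)
  have : (Finset.univ.filter fun i => offHeads m k d i = 0) = blockHeads m k d := by
    ext i; simp [offHeads]
  rw [this] at h
  have := card_blockHeads_le m k d
  omega

/-- A point of large weight is all-one on one of the first `d` blocks. -/
theorem exists_block_of_lt {m d : ℕ} (k : ℕ) {u : Fin m → ZMod 2} (hu : m < hammingNorm u + d) :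
    ∃ j < d, ∀ i : Fin m, i.val / (k + 1) = j → u i = 1 := by
  have h := hammingNorm_add_card_zeros u
  obtain ⟨j, hj, hj'⟩ := Finset.exists_mem_notMem_of_card_lt_card
    (s := (Finset.univ.filter fun i => u i = 0).image fun i : Fin m => i.val / (k + 1))
    (t := Finset.range d) (by
      rw [Finset.card_range]; exact lt_of_le_of_lt Finset.card_image_le (by omega))
  refine ⟨j, Finset.mem_range.mp hj, fun i hi => (eq_zero_or_one (u i)).resolve_left fun h0 => ?_⟩
  exact hj' (Finset.mem_image.mpr ⟨i, by simpa using h0, hi⟩)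

/-- A vector supported on block `j` that contains its head has odd inner product with
`u + offHeads` whenever `u` is all-one on that block. -/
theorem add_offHeads_dotProduct {m k d j : ℕ} (hd : d * (k + 1) ≤ m) (hj : j < d)
    {u t : Fin m → ZMod 2} (hu : ∀ i : Fin m, i.val / (k + 1) = j → u i = 1)
    (ht : ∀ i : Fin m, i.val / (k + 1) ≠ j → t i = 0)
    (ht' : ∀ i : Fin m, i.val = j * (k + 1) → t i = 1) :
    (u + offHeads m k d) ⬝ᵥ t = 1 := by
  have hlt : j * (k + 1) < d * (k + 1) := Nat.mul_lt_mul_of_pos_right hj (Nat.succ_pos k)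
  have hdiv : j * (k + 1) / (k + 1) = j := Nat.mul_div_cancel _ (Nat.succ_pos k)
  -- On block `j`, `u + offHeads` is `1` at the head and `1 + 1 = 0` elsewhere, so only the head
  -- contributes.
  rw [dotProduct, Finset.sum_eq_single ⟨j * (k + 1), hlt.trans_le hd⟩]
  · simp [ht', hu, hdiv, offHeads, blockHeads, hlt]
  · intro i _ hi
    by_cases hij : i.val / (k + 1) = j
    · have : i ∉ blockHeads m k d := fun h => hi (Fin.ext
        ((Nat.div_mul_cancel (Finset.mem_filter.mp h).2.2).symm.trans (by rw [hij])))
      have h2 : (1 + 1 : ZMod 2) = 0 := rfl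
      simp [hu i hij, offHeads, this, h2]
    · simp [ht i hij]
  · simp

/-- The points that are constant on blocks of length `k + 1` and all-one outside the first
`d` blocks. -/
def blockConst (m k d : ℕ) : Finset (Fin m → ZMod 2) :=
  Finset.univ.filter fun a => (∀ i i' : Fin m, i.val / (k + 1) = i'.val / (k + 1) → a i = a i') ∧
    ∀ i : Fin m, d * (k + 1) ≤ i.val → a i = 1

theorem one_mem_blockConst (m k d : ℕ) : (fun _ => 1) ∈ blockConst m k d := by
  simp [blockConst]

/-- One zero forces a whole block of `k + 1` zeros. This keeps `A`, apart from the all-one point,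
below the weights where `g_a = 1` is prescribed. -/
theorem hammingNorm_add_lt_of_mem_blockConst {m k d : ℕ} (hd : d * (k + 1) ≤ m)
    {a : Fin m → ZMod 2} (ha : a ∈ blockConst m k d) (h1 : a ≠ fun _ => 1) :
    hammingNorm a + k < m := by
  obtain ⟨-, hc, ho⟩ := Finset.mem_filter.mp ha
  obtain ⟨i, hi⟩ := Function.ne_iff.mp h1
  have hi0 : a i = 0 := (eq_zero_or_one (a i)).resolve_right hi
  have hid : i.val < d * (k + 1) := lt_of_not_ge fun h => hi (ho i h)
  have hq : i.val / (k + 1) < d := Nat.div_lt_of_lt_mul (by rwa [mul_comm])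
  have hb : ∀ r < k + 1, i.val / (k + 1) * (k + 1) + r < m := fun r hr => by
    have : (i.val / (k + 1) + 1) * (k + 1) ≤ d * (k + 1) := Nat.mul_le_mul_right _ hq
    rw [add_mul] at this
    omega
  have hz : k + 1 ≤ (Finset.univ.filter fun i => a i = 0).card := by
    let φ : Fin (k + 1) → Fin m := fun r => ⟨i.val / (k + 1) * (k + 1) + r.val, hb r r.2⟩
    have hφ : Function.Injective φ := fun r s h => Fin.ext (by simpa [φ] using h)
    rw [← Fintype.card_fin (k + 1), ← Finset.card_univ, ← Finset.card_image_of_injective _ hφ]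
    refine Finset.card_le_card fun x hx => ?_
    obtain ⟨r, -, rfl⟩ := Finset.mem_image.mp hx
    refine Finset.mem_filter.mpr ⟨Finset.mem_univ _, (hc _ i ?_).trans hi0⟩
    change (i.val / (k + 1) * (k + 1) + r.val) / (k + 1) = i.val / (k + 1)
    rw [mul_comm, Nat.mul_add_div (Nat.succ_pos k), Nat.div_eq_of_lt r.2, add_zero]
  have := hammingNorm_add_card_zeros a
  omega

theorem sum_blockConst_eq_zero {m k d j : ℕ} (hd : d * (k + 1) ≤ m) (hj : j < d)
    {u : Fin m → ZMod 2} (hu : ∀ i : Fin m, i.val / (k + 1) = j → u i = 1) :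
    ∑ a ∈ blockConst m k d, sign ((u + offHeads m k d) ⬝ᵥ a) = 0 := by
  refine sum_sign_dotProduct_eq_zero (t := fun i => if i.val / (k + 1) = j then 1 else 0) ?_ ?_
  · intro a ha
    obtain ⟨-, hc, ho⟩ := Finset.mem_filter.mp ha
    refine Finset.mem_filter.mpr ⟨Finset.mem_univ _, fun i i' h => ?_, fun i hi => ?_⟩
    · simp only [Pi.add_apply, hc i i' h, h]
    · have : d ≤ i.val / (k + 1) := (Nat.le_div_iff_mul_le (Nat.succ_pos k)).mpr hi
      simp only [Pi.add_apply, ho i hi, if_neg (show ¬ i.val / (k + 1) = j by omega), add_zero]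
  · exact add_offHeads_dotProduct hd hj hu (fun i hi => if_neg hi) fun i hi => if_pos (by
      rw [hi, Nat.mul_div_cancel _ (Nat.succ_pos k)])

/-- The points that vanish off the block heads, except at the index `1`, where they are `1`. -/
def headCube (m k d : ℕ) : Finset (Fin m → ZMod 2) :=
  Finset.univ.filter fun a => ∀ i : Fin m, (i.val = 1 → a i = 1) ∧
    (i.val ≠ 1 → i ∉ blockHeads m k d → a i = 0)

theorem not_dvd_one {k : ℕ} (hk : 1 ≤ k) : ¬ (k + 1) ∣ 1 := fun h => by
  have := Nat.le_of_dvd one_pos h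
  omega

theorem headCube_nonempty (m k d : ℕ) : (headCube m k d).Nonempty :=
  ⟨fun i => if i.val = 1 then 1 else 0, Finset.mem_filter.mpr
    ⟨Finset.mem_univ _, fun _ => ⟨fun h => if_pos h, fun h _ => if_neg h⟩⟩⟩

theorem sum_headCube_eq_zero {m k d j : ℕ} (hk : 1 ≤ k) (hd : d * (k + 1) ≤ m) (hj : j < d)
    {u : Fin m → ZMod 2} (hu : ∀ i : Fin m, i.val / (k + 1) = j → u i = 1) :
    ∑ a ∈ headCube m k d, sign ((u + offHeads m k d) ⬝ᵥ a) = 0 := by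
  refine sum_sign_dotProduct_eq_zero (t := fun i => if i.val = j * (k + 1) then 1 else 0) ?_ ?_
  · intro a ha
    have ha := (Finset.mem_filter.mp ha).2
    have hlt : j * (k + 1) < d * (k + 1) := Nat.mul_lt_mul_of_pos_right hj (Nat.succ_pos k)
    refine Finset.mem_filter.mpr ⟨Finset.mem_univ _, fun i => ⟨fun h => ?_, fun h hi => ?_⟩⟩
    · have : i.val ≠ j * (k + 1) := fun h' => not_dvd_one hk ⟨j, by rw [mul_comm, ← h', h]⟩
      simp [(ha i).1 h, this]
    · have : i.val ≠ j * (k + 1) := fun h' => hi (Finset.mem_filter.mpr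
        ⟨Finset.mem_univ _, h' ▸ hlt, h' ▸ Dvd.intro_left j rfl⟩)
      simp [(ha i).2 h hi, this]
  · refine add_offHeads_dotProduct hd hj hu (fun i hi => if_neg fun h => hi ?_) fun i hi => if_pos hi
    rw [h, Nat.mul_div_cancel _ (Nat.succ_pos k)]

theorem hammingNorm_le_of_mem_headCube {m k d : ℕ} (hm : 1 < m) {a : Fin m → ZMod 2}
    (ha : a ∈ headCube m k d) : hammingNorm a ≤ d + 1 := by
  have ha := (Finset.mem_filter.mp ha).2
  have : (Finset.univ.filter fun i => a i ≠ 0) ⊆ insert ⟨1, hm⟩ (blockHeads m k d) := by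
    intro i hi
    by_contra h
    rw [Finset.mem_insert, not_or] at h
    exact (Finset.mem_filter.mp hi).2 ((ha i).2 (fun h' => h.1 (Fin.ext h')) h.2)
  exact ((Finset.card_le_card this).trans (Finset.card_insert_le _ _)).trans
    (Nat.succ_le_succ (card_blockHeads_le m k d))

/-- For `k ≥ 2` the indices `1` and `2` share a block and are not heads; points of `headCube` take
the values `1` and `0` there. -/
theorem disjoint_blockConst_headCube {m k d : ℕ} (hk : 2 ≤ k) (hm : 2 < m) :
    Disjoint (blockConst m k d) (headCube m k d) := by
  refine Finset.disjoint_left.mpr fun a ha ha' => ?_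
  have h1 := (Finset.mem_filter.mp ha).2.1 ⟨1, by omega⟩ ⟨2, hm⟩
    (by rw [Nat.div_eq_of_lt (by simp; omega), Nat.div_eq_of_lt (by simp; omega)])
  have ha' := (Finset.mem_filter.mp ha').2
  rw [(ha' ⟨1, by omega⟩).1 rfl, (ha' ⟨2, hm⟩).2 (by simp) fun h => ?_] at h1
  · exact one_ne_zero h1
  · have := Nat.le_of_dvd two_pos (Finset.mem_filter.mp h).2.2
    omega

/-! ### The construction with degree exactly `n - d`. -/

theorem exists_mem_MMSplit_pdeg_eq {n₁ n₂ k d : ℕ} (hd : d * (k + 1) ≤ n₁) (hdn : d ≤ n₂)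
    (hk : 1 ≤ k) (hkn : k ≤ n₂) (hdk : 2 ≤ k → d + k + 2 ≤ n₁) :
    ∃ f ∈ MMSplit (rfl : n₁ + n₂ = n₁ + n₂) k, pdeg f = n₁ + n₂ - d := by
  set q : (Fin n₂ → ZMod 2) → ZMod 2 := fun y => ∑ i, y i with hq
  set u₀ := offHeads n₁ k d with hu₀
  set A := blockConst n₁ k d with hA
  obtain ⟨A', hAA', hA'n, hA'0, hne⟩ : ∃ A' : Finset (Fin n₁ → ZMod 2), Disjoint A A' ∧
      (∀ a ∈ A', hammingNorm a + k < n₁) ∧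
      (∀ j < d, ∀ u : Fin n₁ → ZMod 2, (∀ i : Fin n₁, i.val / (k + 1) = j → u i = 1) →
        ∑ a ∈ A', sign ((u + u₀) ⬝ᵥ a) = 0) ∧
      (A.card : ℤ) * walsh (sym k n₂) (fun _ => 1) + A'.card * walsh q (fun _ => 1) ≠ 0 := by
    by_cases h0 : walsh (sym k n₂) (fun _ => 1) = 0
    -- For `k = 1`, `sym` is the parity, whose spectrum is nonzero at the all-one point.
    · have hk2 : 2 ≤ k := by
        by_contra h
        obtain rfl : k = 1 := by omega
        rw [sym_one] at h0
        exact walsh_sum_one n₂ h0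
      have := hdk hk2
      refine ⟨headCube n₁ k d, disjoint_blockConst_headCube hk2 (by omega), fun a ha => ?_,
        fun j hj u hu => sum_headCube_eq_zero hk hd hj hu, ?_⟩
      · have := hammingNorm_le_of_mem_headCube (by omega) ha
        omega
      · rw [h0, mul_zero, zero_add]
        exact mul_ne_zero (by exact_mod_cast (headCube_nonempty n₁ k d).card_pos.ne')
          (walsh_sum_one n₂)
    · refine ⟨∅, Finset.disjoint_empty_right _, by simp, by simp, ?_⟩
      simpa using ⟨Finset.ne_empty_of_mem (one_mem_blockConst n₁ k d), h0⟩
  set g : (Fin n₁ → ZMod 2) → (Fin n₂ → ZMod 2) → ZMod 2 := fun x y =>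
    if x ∈ A then sym k n₂ y + u₀ ⬝ᵥ (x + 1) else
      if x ∈ A' then q y + u₀ ⬝ᵥ (x + 1) else 1 with hg
  set f : (Fin (n₁ + n₂) → ZMod 2) → ZMod 2 := fun z =>
    g (fun i => z (Fin.castAdd n₂ i)) (fun i => z (Fin.natAdd n₁ i)) with hf
  have hfg : ∀ x y, f (Fin.append x y) = g x y := fun x y => by simp [hf]
  have hw := fun u v (hv : v ≠ 0) => walsh_of_two_pieces hAA' hfg u (v := v) hv
  refine ⟨f, ⟨hkn, g, ?_, ?_, fun x y => (hfg x y).trans (sum_ac_mul g x y).symm⟩,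
    le_antisymm ?_ ?_⟩
  · have h2 : (fun _ => 1 : Fin n₁ → ZMod 2) + 1 = 0 := funext fun _ => rfl
    funext y
    simp only [hg, if_pos (one_mem_blockConst n₁ k d), hA, h2, dotProduct_zero, add_zero]
  · intro a ha1 ha2
    have h1 : a ∉ A := fun h => by
      have := hammingNorm_add_lt_of_mem_blockConst hd h (by
        rintro rfl
        simp [hammingNorm] at ha1)
      omega
    have h2 : a ∉ A' := fun h => by
      have := hA'n a h
      omega
    simp only [hg, h1, h2, if_false]
  · refine Finset.sup_le fun w hw' => ?_
    replace hw' := (Finset.mem_filter.mp hw').2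
    by_contra hlt
    obtain ⟨u, v, rfl⟩ : ∃ u v, w = Fin.append u v :=
      ⟨_, _, (Fin.append_castAdd_natAdd (f := w)).symm⟩
    rw [hammingNorm_append] at hlt
    have hvn : hammingNorm v ≤ n₂ := by simpa using hammingNorm_le_card_fintype (x := v)
    have hun : hammingNorm u ≤ n₁ := by simpa using hammingNorm_le_card_fintype (x := u)
    have hv : v ≠ 0 := by
      rintro rfl
      rw [hammingNorm_zero] at hlt
      omega
    -- As `wt(v) ≤ n₂`, the vector `u` has fewer than `d` zeros and misses a block.
    obtain ⟨j, hj, hu⟩ := exists_block_of_lt (d := d) k (u := u) (by omega)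
    rw [hw u v hv, sum_blockConst_eq_zero hd hj hu, hA'0 j hj u hu] at hw'
    simp at hw'
  · have hv : (fun _ => 1 : Fin n₂ → ZMod 2) ≠ 0 := fun h =>
      one_ne_zero (congrFun h ⟨0, by omega⟩)
    have hu2 : u₀ + u₀ = 0 := funext fun i => by
      have : ∀ z : ZMod 2, z + z = 0 := by decide
      exact this _
    have hmem : walsh f (Fin.append u₀ fun _ => 1) ≠ 0 := by
      rw [hw u₀ _ hv, hu2]
      simpa [sign_zero, sign_ne_zero] using hne
    have hle : hammingNorm (Fin.append u₀ fun _ => 1) ≤ pdeg f :=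
      Finset.le_sup (Finset.mem_filter.mpr ⟨Finset.mem_univ _, hmem⟩)
    rw [hammingNorm_append] at hle
    have h1 : hammingNorm (fun _ => 1 : Fin n₂ → ZMod 2) = n₂ := by simp [hammingNorm]
    have h2 : n₁ ≤ hammingNorm u₀ + d := le_hammingNorm_offHeads_add n₁ k d
    rw [h1] at hle
    omega

/-! ### Choice of `d` and the floor formula. -/

/-- For `d ≥ 1` the exponential hypothesis says that `d - 1` is less than the logarithmic
expression. The construction needs only room for the blocks and for `headCube`, which follows from
linear lower bounds on `2^(k(d-1))`. -/
theorem exists_of_deficit {n k d : ℕ} (hk : 1 ≤ k) (hn : 4 * k ≤ n)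
    (hd : d = 0 ∨ 2 * k * 2 ^ (k * (d - 1)) + 2 * k < n) :
    ∃ f ∈ MM n k, IsSensitiveOfOrder k f ∧ pdeg f = n - d ∧ d ≤ n := by
  have hh : n = (n + 1) / 2 + n / 2 := by omega
  have key : d = 0 ∨ (d * (k + 1) ≤ (n + 1) / 2 ∧ (2 ≤ k → d + k + 2 ≤ (n + 1) / 2)) := by
    rcases Nat.eq_zero_or_pos d with h0 | hpos
    · exact Or.inl h0
    replace hd := hd.resolve_left hpos.ne'
    obtain ⟨e, rfl⟩ : ∃ e, d = e + 1 := ⟨d - 1, by omega⟩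
    have h1 : k * e + 1 ≤ 2 ^ (k * e) := Nat.lt_two_pow_self
    have h2 : 2 * (k * e) ≤ 2 ^ (k * e) := by
      rcases Nat.eq_zero_or_pos (k * e) with h | h
      · simp [h]
      · obtain ⟨x, hx⟩ := Nat.exists_eq_succ_of_ne_zero h.ne'
        rw [hx, pow_succ]
        have : x + 1 ≤ 2 ^ x := Nat.lt_two_pow_self
        omega
    rw [Nat.add_sub_cancel] at hd
    have h3 : k * (2 * (k * e)) ≤ k * 2 ^ (k * e) := Nat.mul_le_mul_left _ h2
    have h4 : k * 1 ≤ k * 2 ^ (k * e) := Nat.mul_le_mul_left _ (by omega)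
    have h5 : k * e ≤ k * (k * e) := Nat.le_mul_of_pos_left _ hk
    have h6 : e ≤ k * e := Nat.le_mul_of_pos_left _ hk
    have hd' : 2 * (k * 2 ^ (k * e)) + 2 * k < n := by rwa [← mul_assoc]
    refine Or.inr ⟨?_, fun hk2 => ?_⟩
    · have : (e + 1) * (k + 1) = k * e + e + k + 1 := by ring
      have : k * (2 * (k * e)) = 2 * (k * (k * e)) := by ring
      omega
    · have h7 : k * (k * e + 1) ≤ k * 2 ^ (k * e) := Nat.mul_le_mul_left _ h1
      have : k * (k * e + 1) = k * (k * e) + k := by ring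
      omega
  have hd1 : d * (k + 1) ≤ (n + 1) / 2 := by
    rcases key with rfl | h
    · simp
    · exact h.1
  have hd2 : 2 * d ≤ d * (k + 1) := by
    rw [mul_comm]; exact Nat.mul_le_mul_left _ (by omega)
  obtain ⟨f, hf, hp⟩ := exists_mem_MMSplit_pdeg_eq (n₁ := (n + 1) / 2) (n₂ := n / 2) (k := k)
    (d := d) hd1 (by omega) hk (by omega) (by
      rcases key with rfl | h
      · omega
      · exact h.2)
  have : ∀ N (hN : (n + 1) / 2 + n / 2 = N), ∃ f ∈ MMSplit hN k, pdeg f = N - d := by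
    rintro N rfl
    exact ⟨f, hf, hp⟩
  obtain ⟨f, hf, hp⟩ := this n hh.symm
  exact ⟨f, ⟨_, _, hh.symm, by omega, hf⟩, isSensitiveOfOrder_of_mem_MMSplit hf, hp, by omega⟩

theorem exists_pdeg_eq_floor {n k : ℕ} (hk : 1 ≤ k) (hn : 4 * k ≤ n) :
    ∃ f ∈ MM n k, IsSensitiveOfOrder k f ∧
      (pdeg f : ℤ) = ⌊(n : ℝ) - (Real.logb 2 ((n : ℝ) / 2 - k) - Real.logb 2 k) / k⌋ := by
  set L : ℝ := (Real.logb 2 ((n : ℝ) / 2 - k) - Real.logb 2 k) / k with hL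
  have hk0 : (0 : ℝ) < k := by exact_mod_cast hk
  have hn' : (4 : ℝ) * k ≤ n := by exact_mod_cast hn
  have hx : (0 : ℝ) < n / 2 - k := by linarith
  have hL0 : 0 ≤ L := div_nonneg (sub_nonneg.mpr
    (Real.logb_le_logb_of_le one_lt_two hk0 (by linarith))) hk0.le
  obtain ⟨f, hf, hs, hp, hd⟩ := exists_of_deficit (d := ⌈L⌉₊) hk hn (by
    rcases Nat.eq_zero_or_pos ⌈L⌉₊ with h | h
    · exact Or.inl h
    right
    have h1 : ((⌈L⌉₊ - 1 : ℕ) : ℝ) < L := Nat.lt_ceil.mp (by omega)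
    rw [hL, lt_div_iff₀ hk0, lt_sub_iff_add_lt, Real.lt_logb_iff_rpow_lt one_lt_two hx,
      Real.rpow_add two_pos, Real.rpow_logb two_pos (by norm_num) hk0] at h1
    have h2 : (2 : ℝ) ^ (((⌈L⌉₊ - 1 : ℕ) : ℝ) * k) = 2 ^ (k * (⌈L⌉₊ - 1)) := by
      rw [← Nat.cast_mul, Real.rpow_natCast, mul_comm]
    rw [h2] at h1
    have : (2 : ℝ) * k * 2 ^ (k * (⌈L⌉₊ - 1)) + 2 * k < n := by linarith
    exact_mod_cast this)
  refine ⟨f, hf, hs, ?_⟩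
  rw [hp, Nat.cast_sub hd, Int.natCast_ceil_eq_ceil hL0, sub_eq_add_neg (n : ℝ),
    Int.floor_natCast_add, Int.floor_neg, sub_eq_add_neg]

/-! ### Asymptotics for `k = o(log n)`. -/

theorem tendsto_deficit {k : ℕ → ℕ} (hk : ∀ᶠ n in atTop, 1 ≤ k n)
    (hko : (fun n => (k n : ℝ)) =o[atTop] (fun n : ℕ => Real.log n)) :
    Tendsto (fun n : ℕ => (Real.logb 2 ((n : ℝ) / 2 - k n) - Real.logb 2 (k n)) / k n)
      atTop atTop := by
  have hnat := tendsto_natCast_atTop_atTop (R := ℝ)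
  have hlog := Real.tendsto_log_atTop.comp hnat
  have hsq : (fun n : ℕ => (k n : ℝ)) =o[atTop] fun n : ℕ => (n : ℝ) ^ (1 / 2 : ℝ) :=
    hko.trans ((isLittleO_log_rpow_atTop (by norm_num)).comp_tendsto hnat)
  rw [tendsto_atTop]
  intro C
  -- The factor `2` absorbs the half in `log √n = (log n) / 2`.
  have hC : (0 : ℝ) < 1 / (2 * (|C| + 1)) := by positivity
  filter_upwards [hk, hko.bound hC, hsq.bound (show (0 : ℝ) < 1 / 4 by norm_num),
    eventually_ge_atTop 1] with n h1 h2 h3 hn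
  have hk0 : (0 : ℝ) < k n := by exact_mod_cast h1
  have hn1 : (1 : ℝ) ≤ n := by exact_mod_cast hn
  have hlog0 : 0 ≤ Real.log n := Real.log_nonneg hn1
  rw [Real.norm_of_nonneg hk0.le, Real.norm_of_nonneg hlog0] at h2
  rw [Real.norm_of_nonneg hk0.le, Real.norm_of_nonneg (by positivity)] at h3
  set s : ℝ := (n : ℝ) ^ (1 / 2 : ℝ) with hs
  have hs0 : 1 ≤ s := Real.one_le_rpow hn1 (by norm_num)
  have hss : s * s = n := by
    rw [hs, ← Real.rpow_add (by linarith)]; norm_num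
  -- From `k ≤ s / 4` and `s ≥ 1`, both `s * k` and `k` are at most `n / 4`.
  have hx : s * k n ≤ n / 2 - k n := by nlinarith
  have hlogs : Real.log s = Real.log n / 2 := by
    rw [hs, Real.log_rpow (by linarith)]; ring
  have h4 : Real.log s + Real.log (k n) ≤ Real.log ((n : ℝ) / 2 - k n) := by
    rw [← Real.log_mul (by linarith) hk0.ne']
    exact Real.log_le_log (by positivity) hx
  rw [le_div_iff₀ hk0, Real.logb, Real.logb, ← sub_div, le_div_iff₀ (Real.log_pos one_lt_two)]
  have hl2 : Real.log 2 ≤ 1 := by linarith [Real.log_two_lt_d9]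
  have h5 : 2 * (|C| + 1) * k n ≤ Real.log n := by
    rw [div_mul_eq_mul_div, one_mul, le_div_iff₀ (by positivity)] at h2
    linarith
  calc C * k n * Real.log 2 ≤ |C| * k n * 1 :=
        mul_le_mul (mul_le_mul_of_nonneg_right (le_abs_self C) hk0.le) hl2
          (Real.log_pos one_lt_two).le (by positivity)
    _ ≤ _ := by linarith

theorem exists_tendsto_deficit (k : ℕ → ℕ) (hk : ∀ᶠ n in atTop, 1 ≤ k n)
    (hko : (fun n => (k n : ℝ)) =o[atTop] (fun n : ℕ => Real.log n)) :
    ∃ f : ∀ n : ℕ, (Fin n → ZMod 2) → ZMod 2,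
      (∀ᶠ n in atTop, f n ∈ MM n (k n) ∧ IsSensitiveOfOrder (k n) (f n)) ∧
      Tendsto (fun n : ℕ => (n : ℤ) - (pdeg (f n) : ℤ)) atTop atTop := by
  have hchoice : ∀ n : ℕ, ∃ f : (Fin n → ZMod 2) → ZMod 2, 1 ≤ k n → 4 * k n ≤ n →
      f ∈ MM n (k n) ∧ IsSensitiveOfOrder (k n) f ∧ (pdeg f : ℤ) =
        ⌊(n : ℝ) - (Real.logb 2 ((n : ℝ) / 2 - k n) - Real.logb 2 (k n)) / k n⌋ := by
    intro n
    by_cases h : 1 ≤ k n ∧ 4 * k n ≤ n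
    · obtain ⟨f, hf⟩ := exists_pdeg_eq_floor h.1 h.2
      exact ⟨f, fun _ _ => hf⟩
    · exact ⟨0, fun h1 h2 => absurd ⟨h1, h2⟩ h⟩
  choose f hf using hchoice
  have h4 : ∀ᶠ n in atTop, 4 * k n ≤ n := by
    have ho : (fun n : ℕ => (k n : ℝ)) =o[atTop] fun n : ℕ => (n : ℝ) :=
      hko.trans (Real.isLittleO_log_id_atTop.comp_tendsto tendsto_natCast_atTop_atTop)
    filter_upwards [ho.bound (show (0 : ℝ) < 1 / 4 by norm_num)] with n h
    rw [Real.norm_natCast, Real.norm_natCast] at h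
    have : (4 : ℝ) * k n ≤ n := by linarith
    exact_mod_cast this
  refine ⟨f, ?_, ?_⟩
  · filter_upwards [hk, h4] with n h1 h2
    exact ⟨(hf n h1 h2).1, (hf n h1 h2).2.1⟩
  · rw [← tendsto_intCast_atTop_iff (R := ℝ)]
    refine tendsto_atTop_mono' _ ?_ (tendsto_deficit hk hko)
    filter_upwards [hk, h4] with n h1 h2
    have := Int.floor_le
      ((n : ℝ) - (Real.logb 2 ((n : ℝ) / 2 - k n) - Real.logb 2 (k n)) / k n)
    rw [← (hf n h1 h2).2.2] at this
    push_cast at this ⊢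
    linarith

end MMSens

theorem mainTheorem1 :
    -- `k`-th order sensitive functions of degree `n - (log (n/2 - k) - log k) / k`
    (∀ n k : ℕ, 1 ≤ k → 4 * k ≤ n →
      ∃ f ∈ MMSens.MM n k, MMSens.IsSensitiveOfOrder k f ∧
        (MMSens.pdeg f : ℤ) =
          ⌊(n : ℝ) - (Real.logb 2 ((n : ℝ) / 2 - k) - Real.logb 2 k) / k⌋) ∧
    -- order `k = o(log n)` is compatible with degree `n - ω(1)`
    (∀ k : ℕ → ℕ, (∀ᶠ n in atTop, 1 ≤ k n) →
      (fun n => (k n : ℝ)) =o[atTop] (fun n : ℕ => Real.log n) →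
      ∃ f : ∀ n : ℕ, (Fin n → ZMod 2) → ZMod 2,
        (∀ᶠ n in atTop, f n ∈ MMSens.MM n (k n) ∧ MMSens.IsSensitiveOfOrder (k n) (f n)) ∧
        Tendsto (fun n : ℕ => (n : ℤ) - (MMSens.pdeg (f n) : ℤ)) atTop atTop) ∧
    -- sensitivity of order `ω(1)` together with degree `n - ω(1)`
    (∃ (k : ℕ → ℕ) (f : ∀ n : ℕ, (Fin n → ZMod 2) → ZMod 2),
      Tendsto k atTop atTop ∧
      (∀ᶠ n in atTop, f n ∈ MMSens.MM n (k n) ∧ MMSens.IsSensitiveOfOrder (k n) (f n)) ∧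
      Tendsto (fun n : ℕ => (n : ℤ) - (MMSens.pdeg (f n) : ℤ)) atTop atTop) := by
  refine ⟨fun n k => MMSens.exists_pdeg_eq_floor, MMSens.exists_tendsto_deficit, ?_⟩
  have hlog : Tendsto (fun n : ℕ => Real.log n) atTop atTop :=
    Real.tendsto_log_atTop.comp tendsto_natCast_atTop_atTop
  -- The order `⌊log log n⌋` is unbounded yet `o(log n)`.
  have hk : Tendsto (fun n : ℕ => ⌊Real.log (Real.log n)⌋₊) atTop atTop :=
    tendsto_nat_floor_atTop.comp (Real.tendsto_log_atTop.comp hlog)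
  have ho : (fun n : ℕ => ((⌊Real.log (Real.log n)⌋₊ : ℕ) : ℝ)) =o[atTop]
      fun n : ℕ => Real.log n := by
    have h1 : (fun n : ℕ => Real.log (Real.log n)) =o[atTop] fun n : ℕ => Real.log n :=
      Real.isLittleO_log_id_atTop.comp_tendsto hlog
    refine IsBigO.trans_isLittleO (IsBigO.of_bound 1 ?_) h1
    filter_upwards [hlog.eventually_ge_atTop 1] with n hn
    have h2 : 0 ≤ Real.log (Real.log n) := Real.log_nonneg hn
    rw [one_mul, Real.norm_natCast, Real.norm_of_nonneg h2]
    exact Nat.floor_le h2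
  obtain ⟨f, hf, hf'⟩ := MMSens.exists_tendsto_deficit _ (hk.eventually_ge_atTop 1) ho
  exact ⟨_, f, hk, hf, hf'⟩
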